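/- Let $M$ be a positive Borel measure on $\mathbb R$ all of whose moments $q_n=\int_{\mathbb R}x^n\,dM(x)$, $n=0,1,2,\dots$, are finite (that is, every $x^n$ is $M$-integrable). Call $M$ indeterminate if there is a positive Borel measure $M'\neq M$ on $\mathbb R$ with finite moments of all orders and $\int x^n\,dM'=q_n$ for all $n\ge 0$. Let $\mathcal D\subset\ell^2=\ell^2(\{0,1,2,\dots\};\mathbb C)$ be the subspace of complex sequences with only finitely many non-zero terms, let $A$ be the operator from $\ell^2$ to $L^2(M)$ with domain $\mathcal D$ given by $$Ag(x)=\sum_{n\ge0}g_nx^n,\qquad g\in\mathcal D,$$ and let $q[g,h]=\sum_{n,m\ge0}q_{n+m}g_n\overline{h_m}$, $g,h\in\mathcal D$, be the Hankel form. The operator $A$ is closable if the closure of its graph is the graph of an operator; the form $q$ is closable in $\ell^2$ if for every sequence $g^{(k)}\in\mathcal D$ with $g^{(k)}\to0$ in $\ell^2$ and $q[g^{(k)}-g^{(l)},g^{(k)}-g^{(l)}]\to0$ as $k,l\to\infty$ one has $q[g^{(k)},g^{(k)}]\to0$. 1. If $M$ is indeterminate, then $A$ is closable, the form $q$ is closable,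 and $q_n$ does not tend to $0$ as $n\to\infty$. 2. For every positive measure $M$ with all moments finite (indeterminate or not), the form $q$ is closable if and only if $A$ is closable. 3. Indeterminate measures exist. Consequently there is a positive measure $M$ with all moments finite for which $A$ is closable but $q_n\not\to0$, so closability of $A$ (equivalently, of $q$) does not imply $q_n\to0$. -/

import Mathlib

open MeasureTheory Filter Topology

noncomputable section

namespace HankelMoment

/-- The complex Hilbert space of square-summable sequences indexed by `0, 1, 2, …`. -/
abbrev EllTwo : Type := lp (fun _ : ℕ => ℂ) 2

/-- The subspace of `ℓ²` of sequences with only finitely many non-zero terms. -/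
def finiteSeq : Submodule ℂ EllTwo where
  carrier := {g | (Function.support fun n => g n).Finite}
  add_mem' {a b} ha hb := by
    refine (Set.Finite.union ha hb).subset ?_
    simpa using Function.support_add (fun n => a n) (fun n => b n)
  zero_mem' := by simp
  smul_mem' c g hg := by
    refine Set.Finite.subset hg ?_
    intro n hn h0
    apply hn
    have h1 : g n = 0 := h0
    simp [h1]

/-- All moments of the positive measure `M` exist and are finite
(the case `n = 0` says that `M` is a finite measure). -/
def HasFiniteMoments (M : Measure ℝ) : Prop :=
  ∀ n : ℕ, Integrable (fun x : ℝ => x ^ n) M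

/-- The `n`-th moment of `M`. -/
def moment (M : Measure ℝ) (n : ℕ) : ℝ := ∫ x, x ^ n ∂M

/-- `M` is indeterminate for the Hamburger moment problem: some other positive measure on the
real line has all its moments finite and equal to those of `M`. -/
def Indeterminate (M : Measure ℝ) : Prop :=
  HasFiniteMoments M ∧
    ∃ M' : Measure ℝ, HasFiniteMoments M' ∧ (∀ n, moment M' n = moment M n) ∧ M' ≠ M

/-- The polynomial function `x ↦ ∑ gₙ xⁿ` on the real line. -/
def polyFun (g : finiteSeq) (x : ℝ) : ℂ := ∑ᶠ n : ℕ, (g : EllTwo) n * (x : ℂ) ^ n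

theorem support_term_finite (g : finiteSeq) (f : ℕ → ℂ) :
    (Function.support fun n => (g : EllTwo) n * f n).Finite :=
  Set.Finite.subset g.2 (Function.support_mul_subset_left _ _)

theorem polyFun_memLp {M : Measure ℝ} (hM : HasFiniteMoments M) (g : finiteSeq) :
    MemLp (polyFun g) 2 M := by
  have hg : (Function.support fun n => (g : EllTwo) n).Finite := g.2
  have e : polyFun g = fun x : ℝ => ∑ n ∈ hg.toFinset, (g : EllTwo) n * (x : ℂ) ^ n := by
    funext x
    refine finsum_eq_sum_of_support_subset _ ?_
    rw [Set.Finite.coe_toFinset]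
    exact Function.support_mul_subset_left _ _
  rw [e]
  refine memLp_finsetSum _ fun n _ => ?_
  refine MemLp.const_mul ?_ _
  have hmeas : AEStronglyMeasurable (fun x : ℝ => (x : ℂ) ^ n) M :=
    (by fun_prop : Continuous fun x : ℝ => (x : ℂ) ^ n).aestronglyMeasurable
  rw [memLp_two_iff_integrable_sq_norm hmeas]
  refine (hM (2 * n)).congr (Eventually.of_forall fun x => ?_)
  simp only [norm_pow, Complex.norm_real, Real.norm_eq_abs]
  rw [← pow_mul, mul_comm n 2, pow_mul, pow_mul, sq_abs]

/-- The operator `g ↦ ∑ gₙ xⁿ` from `ℓ²` to `L²(M)`, whose domain is the space of finite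
sequences. -/
def polyOp (M : Measure ℝ) (hM : HasFiniteMoments M) : EllTwo →ₗ.[ℂ] Lp ℂ 2 M where
  domain := finiteSeq
  toFun :=
    { toFun := fun g => (polyFun_memLp hM g).toLp (polyFun g)
      map_add' := fun g h => by
        rw [← MemLp.toLp_add]
        congr 1
        funext x
        simp only [polyFun, Pi.add_apply, Submodule.coe_add, lp.coeFn_add, add_mul]
        exact finsum_add_distrib (support_term_finite g _) (support_term_finite h _)
      map_smul' := fun c g => by
        rw [RingHom.id_apply, ← MemLp.toLp_const_smul]
        congr 1
        funext x
        simp only [polyFun, Pi.smul_apply, Submodule.coe_smul, lp.coeFn_smul, smul_eq_mul,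
          mul_assoc]
        exact (mul_finsum _ _).symm }

/-- The Hankel form `q[g, h] = ∑ₙ ∑ₘ qₙ₊ₘ gₙ (conj hₘ)` on the space of finite sequences. -/
def hankelForm (q : ℕ → ℝ) (g h : finiteSeq) : ℂ :=
  ∑ᶠ n : ℕ, ∑ᶠ m : ℕ, (q (n + m) : ℂ) * (g : EllTwo) n * starRingEnd ℂ ((h : EllTwo) m)

/-- Closability in `H` of a form `t` with domain `D`: whenever `uₙ ∈ D`, `uₙ → 0` in `H` and
`t[uₙ - uₘ, uₙ - uₘ] → 0` as `n, m → ∞`, one has `t[uₙ, uₙ] → 0`. -/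
def FormIsClosable {H : Type*} [NormedAddCommGroup H] [InnerProductSpace ℂ H]
    (D : Submodule ℂ H) (t : D → D → ℂ) : Prop :=
  ∀ u : ℕ → D,
    Tendsto (fun n => (u n : H)) atTop (𝓝 0) →
    Tendsto (fun p : ℕ × ℕ => t (u p.1 - u p.2) (u p.1 - u p.2)) atTop (𝓝 0) →
    Tendsto (fun n => t (u n) (u n)) atTop (𝓝 0)

end HankelMoment

end

noncomputable section

namespace HankelMoment

/-! ### Injectivity of the Stieltjes transform -/

/-! Let `M` and `M'` be different measures with the same moments. A finite measure on the line is
determined by its Stieltjes transform, so the two transforms differ at some non-real `z₀`. Since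
`(p(x) - p(z₀)) / (x - z₀)` is a polynomial in `x`, its integral is the same for both measures.
Hence `p(z₀)` times the difference of the transforms is a difference of two inner products with
Cauchy kernels, and `|p(z₀)| ≤ C ‖p‖` in `L²(M)` (`exists_norm_eval_le`). Conjugation gives the same
at `conj z₀`.

The bound spreads to the whole plane. For orthonormal polynomials `P n`, the expansion of `(P n - P
n (z₀)) / (X - z₀)` in the `P k`, `k < n`, has coefficients at most `b n * b k` with `b` square
summable (`IsOrthoPoly.inner_divByMonic`). A discrete Gronwall inequality then gives `|P n (z)| ≤ C
b n` on each disc, so point evaluation is bounded on `L²(M)`-normed polynomials, uniformly on discs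
(`IsOrthoPoly.exists_norm_eval_le`).

Now let `g⁽ᵏ⁾ → 0` in `ℓ²` with `A g⁽ᵏ⁾` convergent in `L²(M)`. The polynomials converge locally
uniformly to an entire function. It vanishes on the unit disc, where `ℓ²` controls power series,
hence everywhere; so the `L²` limit is zero and `A` is closable. Evaluating `xⁿ` at 2 gives `4ⁿ ≤ C²
q₂ₙ`, so the moments do not tend to zero.

Closability of `q` and of `A` agree because `q[g, g] = ‖Ag‖²` and `L²(M)` is complete. The
indeterminate example is a discrete measure of log-normal type. -/

theorem norm_sub_real_inv_le {z : ℂ} (hz : z.im ≠ 0) (x : ℝ) :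
    ‖((x : ℂ) - z)⁻¹‖ ≤ |z.im|⁻¹ := by
  rw [norm_inv]
  refine inv_anti₀ (abs_pos.2 hz) ?_
  simpa using Complex.abs_im_le_norm ((x : ℂ) - z)

theorem sub_real_ne_zero {z : ℂ} (hz : z.im ≠ 0) (x : ℝ) : (x : ℂ) - z ≠ 0 := fun h =>
  hz (by simpa using congrArg Complex.im h)

theorem continuous_sub_real_inv {z : ℂ} (hz : z.im ≠ 0) :
    Continuous fun x : ℝ => ((x : ℂ) - z)⁻¹ :=
  Continuous.inv₀ (by fun_prop) (sub_real_ne_zero hz)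

theorem integrable_sub_real_inv {M : Measure ℝ} [IsFiniteMeasure M] {z : ℂ} (hz : z.im ≠ 0) :
    Integrable (fun x : ℝ => ((x : ℂ) - z)⁻¹) M :=
  (integrable_const (|z.im|⁻¹)).mono' (continuous_sub_real_inv hz).aestronglyMeasurable
    (Eventually.of_forall (norm_sub_real_inv_le hz))

/-- The Poisson kernel of the upper half-plane, up to the factor `π`. -/
def poissonKer (ε y : ℝ) : ℝ := ε / (ε ^ 2 + y ^ 2)

theorem poissonKer_denom_pos {ε : ℝ} (hε : 0 < ε) (y : ℝ) : 0 < ε ^ 2 + y ^ 2 := by positivity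

theorem continuous_poissonKer {ε : ℝ} (hε : 0 < ε) : Continuous (poissonKer ε) :=
  Continuous.div (by fun_prop) (by fun_prop) fun y => (poissonKer_denom_pos hε y).ne'

theorem abs_poissonKer_le {ε : ℝ} (hε : 0 < ε) (y : ℝ) : ‖poissonKer ε y‖ ≤ ε⁻¹ := by
  have h := poissonKer_denom_pos hε y
  rw [poissonKer, Real.norm_of_nonneg (by positivity), div_le_iff₀ h]
  have : ε⁻¹ * (ε ^ 2 + y ^ 2) = ε + ε⁻¹ * y ^ 2 := by field_simp
  rw [this]
  have : 0 ≤ ε⁻¹ * y ^ 2 := by positivity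
  linarith

theorem im_sub_real_inv (ε t x : ℝ) :
    (((x : ℂ) - (t + ε * Complex.I))⁻¹).im = poissonKer ε (x - t) := by
  rw [Complex.inv_im, poissonKer]
  simp only [Complex.normSq_apply]
  simp
  ring

theorem integral_poissonKer_eq {M M' : Measure ℝ} [IsFiniteMeasure M] [IsFiniteMeasure M']
    (h : ∀ z : ℂ, z.im ≠ 0 → ∫ x : ℝ, ((x : ℂ) - z)⁻¹ ∂M = ∫ x : ℝ, ((x : ℂ) - z)⁻¹ ∂M')
    {ε : ℝ} (hε : 0 < ε) (t : ℝ) :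
    ∫ x, poissonKer ε (x - t) ∂M = ∫ x, poissonKer ε (x - t) ∂M' := by
  have hz : ((t : ℂ) + ε * Complex.I).im ≠ 0 := by simpa using hε.ne'
  have key : ∀ N : Measure ℝ, IsFiniteMeasure N → ∫ x, poissonKer ε (x - t) ∂N =
      (∫ x : ℝ, ((x : ℂ) - (t + ε * Complex.I))⁻¹ ∂N).im := by
    intro N _
    simp_rw [← im_sub_real_inv]
    exact integral_im (integrable_sub_real_inv hz)
  rw [key M inferInstance, key M' inferInstance, h _ hz]

/-- Substitute `t = x + ε s`. The left side suits dominated convergence, its weight being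
independent of `ε`; the right side suits Fubini. -/
theorem integral_comp_add_mul_inv_one_add_sq (φ : ℝ → ℝ) {ε : ℝ} (hε : 0 < ε) (x : ℝ) :
    ∫ s, φ (x + ε * s) * (1 + s ^ 2)⁻¹ = ∫ t, φ t * poissonKer ε (x - t) := by
  rw [← integral_add_left_eq_self (fun t => φ t * poissonKer ε (x - t)) x]
  have := Measure.integral_comp_mul_left (fun y => φ (x + y) * poissonKer ε (x - (x + y))) ε
  rw [abs_of_pos (inv_pos.2 hε), smul_eq_mul, eq_inv_mul_iff_mul_eq₀ hε.ne'] at this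
  rw [← this, ← integral_const_mul]
  congr 1
  funext s
  have h1 : 1 + s ^ 2 ≠ 0 := by positivity
  have h2 : ε ^ 2 + (x - (x + ε * s)) ^ 2 = ε ^ 2 * (1 + s ^ 2) := by ring
  rw [poissonKer, h2]
  field_simp

/-- Dominated convergence twice: in `s` with dominating function `C / (1 + s²)`, then in `x` with
the constant `C π`, which is integrable because `M` is finite. -/
theorem tendsto_integral_poisson (M : Measure ℝ) [IsFiniteMeasure M]
    (φ : CompactlySupportedContinuousMap ℝ ℝ) :
    Tendsto (fun n : ℕ => ∫ x, (∫ s, φ (x + (1 / ((n : ℝ) + 1)) * s) * (1 + s ^ 2)⁻¹) ∂M) atTop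
      (𝓝 (∫ x, φ x * Real.pi ∂M)) := by
  obtain ⟨C, hC⟩ := φ.hasCompactSupport.exists_bound_of_continuous φ.continuous
  have hmeas : ∀ a : ℝ, Continuous fun p : ℝ × ℝ => φ (p.1 + a * p.2) * (1 + p.2 ^ 2)⁻¹ := by
    intro a
    refine Continuous.mul (φ.continuous.comp (by fun_prop)) (Continuous.inv₀ (by fun_prop) ?_)
    intro p
    positivity
  have hb : ∀ a x s : ℝ, ‖φ (x + a * s) * (1 + s ^ 2)⁻¹‖ ≤ C * (1 + s ^ 2)⁻¹ := by
    intro a x s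
    rw [norm_mul, Real.norm_of_nonneg (r := (1 + s ^ 2)⁻¹) (by positivity)]
    exact mul_le_mul_of_nonneg_right (hC _) (by positivity)
  have hint : Integrable (fun s : ℝ => C * (1 + s ^ 2)⁻¹) :=
    integrable_inv_one_add_sq.const_mul C
  refine tendsto_integral_of_dominated_convergence (fun _ => C * Real.pi) ?_
    (integrable_const _) ?_ ?_
  · intro n
    exact ((hmeas _).stronglyMeasurable.integral_prod_right (ν := volume)).aestronglyMeasurable
  · intro n
    refine Eventually.of_forall fun x => ?_
    refine (norm_integral_le_of_norm_le hint (Eventually.of_forall (hb _ x))).trans ?_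
    rw [integral_const_mul, integral_univ_inv_one_add_sq]
  · refine Eventually.of_forall fun x => ?_
    rw [← integral_univ_inv_one_add_sq, ← integral_const_mul]
    refine tendsto_integral_of_dominated_convergence _ ?_ hint
      (fun n => Eventually.of_forall (hb _ x)) ?_
    · intro n
      exact ((hmeas _).comp (Continuous.prodMk_right x)).aestronglyMeasurable
    · refine Eventually.of_forall fun s => Tendsto.mul_const _ ?_
      refine (φ.continuous.tendsto x).comp ?_
      have := (tendsto_one_div_add_atTop_nhds_zero_nat (𝕜 := ℝ)).mul_const s
      simpa using this.const_add x

/-- Fubini moves the smoothing from `φ` to `M`, leaving a Poisson integral of `M`, which is the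
imaginary part of its Stieltjes transform. -/
theorem integral_integral_poisson (M : Measure ℝ) [IsFiniteMeasure M]
    (φ : CompactlySupportedContinuousMap ℝ ℝ) {ε : ℝ} (hε : 0 < ε) :
    ∫ x, (∫ s, φ (x + ε * s) * (1 + s ^ 2)⁻¹) ∂M =
      ∫ t, φ t * ∫ x, poissonKer ε (x - t) ∂M := by
  simp_rw [integral_comp_add_mul_inv_one_add_sq φ hε, ← integral_const_mul]
  refine integral_integral_swap ?_
  have hφ : Integrable (fun t => φ t) volume :=
    φ.continuous.integrable_of_hasCompactSupport φ.hasCompactSupport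
  have h1 : Integrable (fun p : ℝ × ℝ => (1 : ℝ) * φ p.2) (M.prod volume) :=
    (integrable_const (1 : ℝ)).mul_prod hφ
  refine (h1.norm.const_mul ε⁻¹).mono' ?_ (Eventually.of_forall fun p => ?_)
  · refine Continuous.aestronglyMeasurable ?_
    exact (φ.continuous.comp continuous_snd).mul
      ((continuous_poissonKer hε).comp (continuous_fst.sub continuous_snd))
  · simp only [Function.uncurry, norm_mul, one_mul]
    rw [mul_comm]
    exact mul_le_mul_of_nonneg_right (abs_poissonKer_le hε _) (norm_nonneg _)

theorem eq_of_stieltjes_eq {M M' : Measure ℝ} [IsFiniteMeasure M] [IsFiniteMeasure M']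
    (h : ∀ z : ℂ, z.im ≠ 0 → ∫ x : ℝ, ((x : ℂ) - z)⁻¹ ∂M = ∫ x : ℝ, ((x : ℂ) - z)⁻¹ ∂M') :
    M = M' := by
  refine Measure.ext_of_integral_eq_on_compactlySupported fun φ => ?_
  have h1 := tendsto_integral_poisson M φ
  have h2 := tendsto_integral_poisson M' φ
  have e : ∀ n : ℕ, ∫ x, (∫ s, φ (x + (1 / ((n : ℝ) + 1)) * s) * (1 + s ^ 2)⁻¹) ∂M =
      ∫ x, (∫ s, φ (x + (1 / ((n : ℝ) + 1)) * s) * (1 + s ^ 2)⁻¹) ∂M' := by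
    intro n
    have hn : (0 : ℝ) < 1 / ((n : ℝ) + 1) := by positivity
    rw [integral_integral_poisson M φ hn, integral_integral_poisson M' φ hn]
    simp_rw [integral_poissonKer_eq h hn]
  have := tendsto_nhds_unique h1 (h2.congr fun n => (e n).symm)
  rw [integral_mul_const, integral_mul_const] at this
  exact mul_right_cancel₀ Real.pi_ne_zero this

/-! ### Polynomials in `L²(M)` -/

open Polynomial ComplexConjugate

theorem HasFiniteMoments.isFiniteMeasure {M : Measure ℝ} (hM : HasFiniteMoments M) :
    IsFiniteMeasure M := by
  have h := hM 0
  simp only [pow_zero] at h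
  rcases integrable_const_iff.1 h with h | h
  · exact absurd h one_ne_zero
  · exact h

theorem HasFiniteMoments.integrable_ofReal_pow {M : Measure ℝ} (hM : HasFiniteMoments M) (n : ℕ) :
    Integrable (fun x : ℝ => (x : ℂ) ^ n) M := by
  simpa using (hM n).ofReal (𝕜 := ℂ)

theorem integral_ofReal_pow (M : Measure ℝ) (n : ℕ) :
    ∫ x : ℝ, (x : ℂ) ^ n ∂M = (moment M n : ℂ) := by
  rw [moment, ← integral_complex_ofReal]
  simp

theorem HasFiniteMoments.integrable_eval {M : Measure ℝ} (hM : HasFiniteMoments M) (p : ℂ[X]) :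
    Integrable (fun x : ℝ => p.eval (x : ℂ)) M := by
  simp_rw [eval_eq_sum_range]
  exact integrable_finsetSum _ fun n _ => (hM.integrable_ofReal_pow n).const_mul _

theorem HasFiniteMoments.integral_eval {M : Measure ℝ} (hM : HasFiniteMoments M) (p : ℂ[X]) :
    ∫ x : ℝ, p.eval (x : ℂ) ∂M = p.sum fun n a => a * (moment M n : ℂ) := by
  simp_rw [eval_eq_sum, Polynomial.sum]
  rw [integral_finsetSum _ fun n _ => (hM.integrable_ofReal_pow n).const_mul _]
  simp_rw [integral_const_mul, integral_ofReal_pow]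

theorem integral_eval_eq_of_moment_eq {M M' : Measure ℝ} (hM : HasFiniteMoments M)
    (hM' : HasFiniteMoments M') (h : ∀ n, moment M' n = moment M n) (p : ℂ[X]) :
    ∫ x : ℝ, p.eval (x : ℂ) ∂M' = ∫ x : ℝ, p.eval (x : ℂ) ∂M := by
  rw [hM.integral_eval, hM'.integral_eval]
  simp_rw [h]

/-- The polynomial with conjugated coefficients. -/
def conjPoly (p : ℂ[X]) : ℂ[X] := p.map (starRingEnd ℂ)

theorem eval_conjPoly (p : ℂ[X]) (z : ℂ) : (conjPoly p).eval z = conj (p.eval (conj z)) := by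
  have := Polynomial.eval₂_at_apply (p := p) (starRingEnd ℂ) (conj z)
  rw [conjPoly, eval_map]
  simpa using this

theorem eval_conjPoly_ofReal (p : ℂ[X]) (x : ℝ) :
    (conjPoly p).eval (x : ℂ) = conj (p.eval (x : ℂ)) := by
  rw [eval_conjPoly, Complex.conj_ofReal]

theorem continuous_eval_ofReal (p : ℂ[X]) : Continuous fun x : ℝ => p.eval (x : ℂ) :=
  p.continuous.comp Complex.continuous_ofReal

theorem HasFiniteMoments.memLp_eval {M : Measure ℝ} (hM : HasFiniteMoments M) (p : ℂ[X]) :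
    MemLp (fun x : ℝ => p.eval (x : ℂ)) 2 M := by
  rw [memLp_two_iff_integrable_sq_norm (continuous_eval_ofReal p).aestronglyMeasurable]
  refine (hM.integrable_eval (conjPoly p * p)).norm.congr (Eventually.of_forall fun x => ?_)
  simp only [eval_mul, eval_conjPoly_ofReal, norm_mul, RCLike.norm_conj, sq]

/-- A polynomial as an element of `L²(M)`. -/
def polyToLp {M : Measure ℝ} (hM : HasFiniteMoments M) : ℂ[X] →ₗ[ℂ] Lp ℂ 2 M where
  toFun p := (hM.memLp_eval p).toLp _
  map_add' p q := by
    rw [← MemLp.toLp_add]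
    congr 1
    funext x
    simp
  map_smul' c p := by
    rw [RingHom.id_apply, ← MemLp.toLp_const_smul]
    congr 1
    funext x
    simp

theorem coeFn_polyToLp {M : Measure ℝ} (hM : HasFiniteMoments M) (p : ℂ[X]) :
    polyToLp hM p =ᵐ[M] fun x : ℝ => p.eval (x : ℂ) :=
  (hM.memLp_eval p).coeFn_toLp

theorem inner_toLp {M : Measure ℝ} {f g : ℝ → ℂ} (hf : MemLp f 2 M) (hg : MemLp g 2 M) :
    inner ℂ (hf.toLp f) (hg.toLp g) = ∫ x, conj (f x) * g x ∂M := by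
  rw [L2.inner_def]
  refine integral_congr_ae ?_
  filter_upwards [hf.coeFn_toLp, hg.coeFn_toLp] with x h1 h2
  rw [h1, h2, RCLike.inner_apply, mul_comm]

theorem inner_polyToLp {M : Measure ℝ} (hM : HasFiniteMoments M) (p q : ℂ[X]) :
    inner ℂ (polyToLp hM p) (polyToLp hM q) = ∫ x : ℝ, (conjPoly p * q).eval (x : ℂ) ∂M := by
  simp_rw [eval_mul, eval_conjPoly_ofReal]
  exact inner_toLp (hM.memLp_eval p) (hM.memLp_eval q)

theorem norm_polyToLp_eq_of_moment_eq {M M' : Measure ℝ} (hM : HasFiniteMoments M)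
    (hM' : HasFiniteMoments M') (h : ∀ n, moment M' n = moment M n) (p : ℂ[X]) :
    ‖polyToLp hM' p‖ = ‖polyToLp hM p‖ := by
  rw [@norm_eq_sqrt_re_inner ℂ, @norm_eq_sqrt_re_inner ℂ _ _ _ _ (polyToLp hM p), inner_polyToLp,
    inner_polyToLp, integral_eval_eq_of_moment_eq hM hM' h]

/-! ### Division by `X - a` -/

theorem eval_eq_eval_add_divByMonic (p : ℂ[X]) (a z : ℂ) :
    p.eval z = p.eval a + (z - a) * (p /ₘ (X - C a)).eval z := by
  have h := congrArg (Polynomial.eval z) (X_sub_C_mul_divByMonic_eq_sub_modByMonic p a)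
  rw [modByMonic_X_sub_C_eq_C_eval] at h
  simp only [eval_mul, eval_sub, eval_X, eval_C] at h
  rw [h]
  ring

theorem divByMonic_X_sub_C_mem_degreeLT {p : ℂ[X]} {n : ℕ} (hp : p ∈ degreeLT ℂ (n + 1)) (a : ℂ) :
    p /ₘ (X - C a) ∈ degreeLT ℂ n := by
  rw [mem_degreeLT] at hp ⊢
  by_cases h0 : p /ₘ (X - C a) = 0
  · rw [h0, degree_zero]
    exact WithBot.bot_lt_coe n
  · have hp0 : p ≠ 0 := by
      rintro rfl
      simp at h0
    have h1 := degree_divByMonic_lt p (X - C a) hp0 (by rw [degree_X_sub_C]; exact one_pos)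
    rw [degree_eq_natDegree h0, degree_eq_natDegree hp0, Nat.cast_lt] at h1
    rw [degree_eq_natDegree hp0, Nat.cast_lt] at hp
    rw [degree_eq_natDegree h0, Nat.cast_lt]
    omega

/-! ### The Cauchy kernel in `L²(M)` -/

theorem memLp_cauchy {M : Measure ℝ} (hM : HasFiniteMoments M) {z : ℂ} (hz : z.im ≠ 0) :
    MemLp (fun x : ℝ => ((x : ℂ) - z)⁻¹) 2 M := by
  have := hM.isFiniteMeasure
  exact MemLp.of_bound (continuous_sub_real_inv hz).aestronglyMeasurable _
    (Eventually.of_forall (norm_sub_real_inv_le hz))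

/-- The function `x ↦ 1 / (x - z)` as an element of `L²(M)`. -/
def cauchyLp {M : Measure ℝ} (hM : HasFiniteMoments M) {z : ℂ} (hz : z.im ≠ 0) : Lp ℂ 2 M :=
  (memLp_cauchy hM hz).toLp _

theorem conj_im_ne_zero {z : ℂ} (hz : z.im ≠ 0) : (conj z).im ≠ 0 := by simpa using hz

theorem inner_cauchyLp_conj {M : Measure ℝ} (hM : HasFiniteMoments M) {z : ℂ} (hz : z.im ≠ 0)
    (p : ℂ[X]) :
    inner ℂ (cauchyLp hM (conj_im_ne_zero hz)) (polyToLp hM p) =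
      ∫ x : ℝ, ((x : ℂ) - z)⁻¹ * p.eval (x : ℂ) ∂M := by
  refine (inner_toLp (memLp_cauchy hM (conj_im_ne_zero hz)) (hM.memLp_eval p)).trans ?_
  simp

theorem inner_cauchyLp {M : Measure ℝ} (hM : HasFiniteMoments M) {z : ℂ} (hz : z.im ≠ 0)
    (p : ℂ[X]) :
    inner ℂ (polyToLp hM p) (cauchyLp hM hz) =
      ∫ x : ℝ, conj (p.eval (x : ℂ)) * ((x : ℂ) - z)⁻¹ ∂M :=
  inner_toLp (hM.memLp_eval p) (memLp_cauchy hM hz)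

theorem integrable_cauchy_mul_eval {M : Measure ℝ} (hM : HasFiniteMoments M) {z : ℂ}
    (hz : z.im ≠ 0) (p : ℂ[X]) :
    Integrable (fun x : ℝ => ((x : ℂ) - z)⁻¹ * p.eval (x : ℂ)) M :=
  (memLp_cauchy hM hz).integrable_mul (hM.memLp_eval p)

theorem integral_cauchy_mul_eval {M : Measure ℝ} (hM : HasFiniteMoments M) {z : ℂ}
    (hz : z.im ≠ 0) (p : ℂ[X]) :
    ∫ x : ℝ, ((x : ℂ) - z)⁻¹ * p.eval (x : ℂ) ∂M =
      p.eval z * (∫ x : ℝ, ((x : ℂ) - z)⁻¹ ∂M) +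
        ∫ x : ℝ, (p /ₘ (X - C z)).eval (x : ℂ) ∂M := by
  have := hM.isFiniteMeasure
  rw [← integral_const_mul, ← integral_add ((integrable_sub_real_inv hz).const_mul _)
    (hM.integrable_eval _)]
  congr 1
  funext x
  rw [eval_eq_eval_add_divByMonic p z x]
  field_simp [sub_real_ne_zero hz x]

/-! ### Indeterminate measures: bounded point evaluation at some non-real point -/

/-- Integrate `p(x) / (x - z) = p(z) / (x - z) + polynomial` against both measures and subtract: the
polynomial part cancels. Cauchy–Schwarz bounds what remains, and `p` has the same norm in `L²(M')`
as in `L²(M)`. -/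
theorem exists_norm_eval_le {M M' : Measure ℝ} (hM : HasFiniteMoments M)
    (hM' : HasFiniteMoments M') (h : ∀ n, moment M' n = moment M n) {z : ℂ} (hz : z.im ≠ 0)
    (hne : ∫ x : ℝ, ((x : ℂ) - z)⁻¹ ∂M' ≠ ∫ x : ℝ, ((x : ℂ) - z)⁻¹ ∂M) :
    ∃ C, ∀ p : ℂ[X], ‖p.eval z‖ ≤ C * ‖polyToLp hM p‖ := by
  set w := (∫ x : ℝ, ((x : ℂ) - z)⁻¹ ∂M') - ∫ x : ℝ, ((x : ℂ) - z)⁻¹ ∂M with hw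
  have hw0 : w ≠ 0 := sub_ne_zero.2 hne
  refine ⟨‖w‖⁻¹ * (‖cauchyLp hM' (conj_im_ne_zero hz)‖ + ‖cauchyLp hM (conj_im_ne_zero hz)‖),
    fun p => ?_⟩
  have key : p.eval z * w =
      inner ℂ (cauchyLp hM' (conj_im_ne_zero hz)) (polyToLp hM' p) -
        inner ℂ (cauchyLp hM (conj_im_ne_zero hz)) (polyToLp hM p) := by
    rw [inner_cauchyLp_conj hM hz, inner_cauchyLp_conj hM' hz, integral_cauchy_mul_eval hM hz,
      integral_cauchy_mul_eval hM' hz, integral_eval_eq_of_moment_eq hM hM' h, hw]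
    ring
  have h2 : ‖p.eval z‖ * ‖w‖ ≤ ‖cauchyLp hM' (conj_im_ne_zero hz)‖ * ‖polyToLp hM p‖ +
      ‖cauchyLp hM (conj_im_ne_zero hz)‖ * ‖polyToLp hM p‖ := by
    rw [← norm_mul, key]
    refine (norm_sub_le _ _).trans (add_le_add ?_ (norm_inner_le_norm _ _))
    rw [← norm_polyToLp_eq_of_moment_eq hM hM' h]
    exact norm_inner_le_norm _ _
  rw [mul_assoc, inv_mul_eq_div, le_div_iff₀ (norm_pos_iff.2 hw0), add_mul]
  exact h2

theorem integral_sub_real_inv_conj (M : Measure ℝ) (z : ℂ) :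
    ∫ x : ℝ, ((x : ℂ) - conj z)⁻¹ ∂M = conj (∫ x : ℝ, ((x : ℂ) - z)⁻¹ ∂M) := by
  rw [← integral_conj]
  simp

/-- For an indeterminate measure there is a pair of conjugate non-real points at which polynomials
can be evaluated continuously in the norm of `L²(M)`. -/
theorem Indeterminate.exists_bounded_eval {M : Measure ℝ} (hM : HasFiniteMoments M)
    (h : Indeterminate M) :
    ∃ z : ℂ, z.im ≠ 0 ∧ (∃ C, ∀ p : ℂ[X], ‖p.eval z‖ ≤ C * ‖polyToLp hM p‖) ∧
      ∃ C, ∀ p : ℂ[X], ‖p.eval (conj z)‖ ≤ C * ‖polyToLp hM p‖ := by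
  obtain ⟨-, M', hM', hmom, hne⟩ := h
  have := hM.isFiniteMeasure
  have := hM'.isFiniteMeasure
  by_contra! hcon
  refine hne (eq_of_stieltjes_eq fun z hz => ?_)
  by_contra hz'
  -- The transforms at `conj z` are the conjugates of those at `z`, so they differ there as well.
  obtain ⟨C', hC'⟩ := exists_norm_eval_le hM hM' hmom (conj_im_ne_zero hz) (by
    rw [integral_sub_real_inv_conj, integral_sub_real_inv_conj]
    exact fun h => hz' ((starRingEnd ℂ).injective h))
  obtain ⟨p, hp⟩ := hcon z hz (exists_norm_eval_le hM hM' hmom hz hz') C'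
  exact absurd (hC' p) (not_le.2 hp)

/-- Descent on the degree: a polynomial that is null in `L²(M)` vanishes at `z` by the bound, and
its quotient by `X - z` is null again, since `x - z` has no real zero. -/
theorem polyToLp_injective {M : Measure ℝ} (hM : HasFiniteMoments M) {z : ℂ} (hz : z.im ≠ 0)
    (hC : ∃ C, ∀ p : ℂ[X], ‖p.eval z‖ ≤ C * ‖polyToLp hM p‖) :
    Function.Injective (polyToLp hM) := by
  obtain ⟨C, hC⟩ := hC
  have key : ∀ n : ℕ, ∀ p ∈ degreeLT ℂ n, polyToLp hM p = 0 → p = 0 := by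
    intro n
    induction n with
    | zero =>
      intro p hp _
      rw [mem_degreeLT] at hp
      exact degree_eq_bot.1 (by simpa using (Nat.WithBot.lt_zero_iff.1 hp))
    | succ n ih =>
      intro p hp h0
      have hz0 : p.eval z = 0 := by
        have := hC p
        rw [h0, norm_zero, mul_zero] at this
        exact norm_le_zero_iff.1 this
      have hr : polyToLp hM (p /ₘ (X - Polynomial.C z)) = 0 := by
        rw [Lp.eq_zero_iff_ae_eq_zero] at h0 ⊢
        filter_upwards [h0, coeFn_polyToLp hM p, coeFn_polyToLp hM (p /ₘ (X - Polynomial.C z))]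
          with x h1 h2 h3
        rw [h3]
        rw [h2, eval_eq_eval_add_divByMonic p z x, hz0, zero_add] at h1
        exact (mul_eq_zero.1 h1).resolve_left (sub_real_ne_zero hz x)
      rw [← mul_divByMonic_eq_iff_isRoot.2 hz0, ih _ (divByMonic_X_sub_C_mem_degreeLT hp z) hr,
        mul_zero]
  refine (injective_iff_map_eq_zero _).2 fun p hp => key (p.natDegree + 1) p ?_ hp
  rw [mem_degreeLT]
  exact (degree_le_natDegree).trans_lt (by exact_mod_cast Nat.lt_succ_self _)

/-! ### Orthonormal polynomials -/

/-- `P` is a sequence of orthonormal polynomials for `M`, with `P n` of degree at most `n`, such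
that every polynomial of degree less than `n` is its Fourier sum of order `n`. -/
structure IsOrthoPoly {M : Measure ℝ} (hM : HasFiniteMoments M) (P : ℕ → ℂ[X]) : Prop where
  orthonormal : Orthonormal ℂ fun n => polyToLp hM (P n)
  mem_degreeLT : ∀ n, P n ∈ degreeLT ℂ (n + 1)
  eq_sum : ∀ n, ∀ q ∈ degreeLT ℂ n,
    q = ∑ k ∈ Finset.range n, inner ℂ (polyToLp hM (P k)) (polyToLp hM q) • P k

/-- Both sides are linear in `y`, so it is enough to check the vectors `v j` with `j < n`. -/
theorem Orthonormal.eq_sum_of_mem_span {E : Type*} [NormedAddCommGroup E] [InnerProductSpace ℂ E]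
    {v : ℕ → E} (hv : Orthonormal ℂ v) (n : ℕ) {y : E}
    (hy : y ∈ Submodule.span ℂ (v '' Set.Iio n)) :
    y = ∑ k ∈ Finset.range n, inner ℂ (v k) y • v k := by
  induction hy using Submodule.span_induction with
  | mem x hx =>
    obtain ⟨j, hj, rfl⟩ := hx
    rw [Finset.sum_eq_single j]
    · rw [inner_self_eq_norm_sq_to_K, hv.1 j]
      simp
    · intro k _ hk
      rw [hv.2 hk, zero_smul]
    · intro h
      exact absurd (Finset.mem_range.2 hj) h
  | zero => simp
  | add x y _ _ hx hy =>
    simp_rw [inner_add_right, add_smul, Finset.sum_add_distrib]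
    rw [← hx, ← hy]
  | smul c x _ hx =>
    simp_rw [inner_smul_right, mul_smul]
    rw [← Finset.smul_sum, ← hx]

theorem exists_isOrthoPoly {M : Measure ℝ} (hM : HasFiniteMoments M)
    (hinj : Function.Injective (polyToLp hM)) : ∃ P, IsOrthoPoly hM P := by
  classical
  set e : ℕ → Lp ℂ 2 M := fun n => polyToLp hM (X ^ n) with he
  have hli : LinearIndependent ℂ e := by
    have h := (basisMonomials ℂ).linearIndependent.map' (polyToLp hM) (LinearMap.ker_eq_bot.2 hinj)
    have h' : polyToLp hM ∘ basisMonomials ℂ = e := by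
      funext n
      simp [he, X_pow_eq_monomial]
    rw [h'] at h
    exact h
  set v := InnerProductSpace.gramSchmidtNormed ℂ e
  have hv : Orthonormal ℂ v := InnerProductSpace.gramSchmidtNormed_orthonormal hli
  -- Gram–Schmidt preserves the initial spans, so each `v n` lifts to a polynomial of degree at most
  -- `n`. Injectivity later turns Fourier identities in `L²(M)` into identities of polynomials.
  have hspan : ∀ n, Submodule.span ℂ (v '' Set.Iio n) = (degreeLT ℂ n).map (polyToLp hM) := by
    intro n
    rw [InnerProductSpace.span_gramSchmidtNormed, InnerProductSpace.span_gramSchmidt_Iio,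
      degreeLT_eq_span_X_pow, Submodule.map_span, Finset.coe_image, Finset.coe_range,
      ← Set.image_comp]
    rfl
  have hmem : ∀ n, ∃ p ∈ degreeLT ℂ (n + 1), polyToLp hM p = v n := by
    intro n
    have : v n ∈ Submodule.span ℂ (v '' Set.Iio (n + 1)) :=
      Submodule.subset_span ⟨n, Nat.lt_succ_self n, rfl⟩
    rw [hspan] at this
    exact this
  choose P hP1 hP2 using hmem
  have hP3 : (fun n => polyToLp hM (P n)) = v := funext hP2
  refine ⟨P, ⟨hP3 ▸ hv, hP1, fun n q hq => hinj ?_⟩⟩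
  have hq' : polyToLp hM q ∈ Submodule.span ℂ (v '' Set.Iio n) := by
    rw [hspan]
    exact ⟨q, hq, rfl⟩
  rw [map_sum]
  simp_rw [map_smul, hP2]
  exact Orthonormal.eq_sum_of_mem_span hv n hq'

section

variable {M : Measure ℝ} {hM : HasFiniteMoments M} {P : ℕ → ℂ[X]}

theorem IsOrthoPoly.inner_eq_zero (hP : IsOrthoPoly hM P) {n : ℕ} {q : ℂ[X]}
    (hq : q ∈ degreeLT ℂ n) : inner ℂ (polyToLp hM q) (polyToLp hM (P n)) = 0 := by
  rw [hP.eq_sum n q hq, map_sum, sum_inner]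
  refine Finset.sum_eq_zero fun k hk => ?_
  rw [map_smul, inner_smul_left, hP.orthonormal.2 (Finset.mem_range.1 hk).ne, mul_zero]

theorem IsOrthoPoly.norm_sq_eq_sum (hP : IsOrthoPoly hM P) {n : ℕ} {q : ℂ[X]}
    (hq : q ∈ degreeLT ℂ n) :
    ‖polyToLp hM q‖ ^ 2 =
      ∑ k ∈ Finset.range n, ‖inner ℂ (polyToLp hM (P k)) (polyToLp hM q)‖ ^ 2 := by
  set c := fun k => inner ℂ (polyToLp hM (P k)) (polyToLp hM q) with hc
  have h : polyToLp hM q = ∑ k ∈ Finset.range n, c k • polyToLp hM (P k) := by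
    conv_lhs => rw [hP.eq_sum n q hq]
    rw [map_sum]
    simp_rw [map_smul, hc]
  have h1 : inner ℂ (polyToLp hM q) (polyToLp hM q) =
      ∑ k ∈ Finset.range n, conj (c k) * c k := by
    conv_lhs => rw [h]
    exact hP.orthonormal.inner_sum c c _
  rw [inner_self_eq_norm_sq_to_K] at h1
  have h2 : ∀ k, conj (c k) * c k = ((‖c k‖ ^ 2 : ℝ) : ℂ) := by
    intro k
    rw [RCLike.conj_mul]
    push_cast
    rfl
  simp_rw [h2] at h1
  rw [← Complex.ofReal_sum] at h1
  have h3 : ((‖polyToLp hM q‖ : ℝ) : ℂ) ^ 2 =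
    ((∑ k ∈ Finset.range n, ‖c k‖ ^ 2 : ℝ) : ℂ) := h1
  exact_mod_cast h3

/-- The values of a bounded functional on orthonormal polynomials are square summable. -/
theorem IsOrthoPoly.summable_sq_eval (hP : IsOrthoPoly hM P) {z : ℂ}
    (hC : ∃ C, ∀ p : ℂ[X], ‖p.eval z‖ ≤ C * ‖polyToLp hM p‖) :
    Summable fun n => ‖(P n).eval z‖ ^ 2 := by
  obtain ⟨C, hC⟩ := hC
  refine summable_of_sum_range_le (c := C ^ 2) (fun _ => by positivity) fun n => ?_
  set s := ∑ k ∈ Finset.range n, ‖(P k).eval z‖ ^ 2 with hs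
  have hs0 : 0 ≤ s := Finset.sum_nonneg fun _ _ => by positivity
  have hsq : ∀ k, conj ((P k).eval z) * (P k).eval z = ((‖(P k).eval z‖ ^ 2 : ℝ) : ℂ) := by
    intro k
    rw [RCLike.conj_mul]
    push_cast
    rfl
  -- The extremal polynomial for evaluation at `z`: `p(z)` and `‖p‖²` both equal `s`, so the bound
  -- reads `s² ≤ C² s`.
  set p : ℂ[X] := ∑ k ∈ Finset.range n, conj ((P k).eval z) • P k with hp
  have h1 : p.eval z = (s : ℂ) := by
    rw [hp, eval_finsetSum, hs, Complex.ofReal_sum]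
    refine Finset.sum_congr rfl fun k _ => ?_
    rw [eval_smul, smul_eq_mul, hsq]
  have h2 : ‖polyToLp hM p‖ ^ 2 = s := by
    have h3 : polyToLp hM p =
        ∑ k ∈ Finset.range n, conj ((P k).eval z) • polyToLp hM (P k) := by
      rw [hp, map_sum]
      simp_rw [map_smul]
    have h4 : inner ℂ (polyToLp hM p) (polyToLp hM p) = ((s : ℝ) : ℂ) := by
      rw [h3, hP.orthonormal.inner_sum, hs, Complex.ofReal_sum]
      refine Finset.sum_congr rfl fun k _ => ?_
      rw [← hsq, mul_comm, Complex.conj_conj, mul_comm, mul_comm]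
    rw [inner_self_eq_norm_sq_to_K] at h4
    have h5 : ((‖polyToLp hM p‖ : ℝ) : ℂ) ^ 2 = (s : ℂ) := h4
    exact_mod_cast h5
  have h5 : s ≤ C * ‖polyToLp hM p‖ := by
    have := hC p
    rwa [h1, Complex.norm_real, Real.norm_of_nonneg hs0] at this
  rcases hs0.eq_or_lt with h0 | h0
  · rw [← h0]
    positivity
  · have h6 : s ^ 2 ≤ C ^ 2 * s := by
      rw [← h2, ← mul_pow, h2]
      exact pow_le_pow_left₀ hs0 h5 2
    rw [sq s] at h6
    exact le_of_mul_le_mul_right h6 h0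

/-- The matrix entries of `p ↦ (p - p(z)) / (X - z)` in the basis of orthonormal polynomials. -/
theorem IsOrthoPoly.inner_divByMonic (hP : IsOrthoPoly hM P) {z : ℂ} (hz : z.im ≠ 0) {k n : ℕ}
    (hkn : k < n) :
    inner ℂ (polyToLp hM (P k)) (polyToLp hM (P n /ₘ (X - C z))) =
      conj ((P k).eval (conj z)) *
          inner ℂ (cauchyLp hM (conj_im_ne_zero hz)) (polyToLp hM (P n)) -
        (P n).eval z * inner ℂ (polyToLp hM (P k)) (cauchyLp hM hz) := by
  -- With `conj P k (x) = conj P k (conj z) + (x - z) conj T(x)`, the product `conj P k · (P n - P n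
  -- (z)) / (x - z)` splits into the two Cauchy terms and `conj T · P n`. The latter integrates to
  -- zero, since `T` has degree below `n`.
  set T := P k /ₘ (X - C (conj z)) with hT
  have hT0 : inner ℂ (polyToLp hM T) (polyToLp hM (P n)) = 0 := by
    refine hP.inner_eq_zero ?_
    refine degreeLT_mono hkn.le ?_
    exact divByMonic_X_sub_C_mem_degreeLT (hP.mem_degreeLT k) _
  have hi1 := (integrable_cauchy_mul_eval hM hz (P n)).const_mul (conj ((P k).eval (conj z)))
  have hi2 : Integrable (fun x : ℝ => conj ((P k).eval (x : ℂ)) * ((x : ℂ) - z)⁻¹) M := by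
    refine (integrable_cauchy_mul_eval hM hz (conjPoly (P k))).congr
      (Eventually.of_forall fun x => ?_)
    simp only [eval_conjPoly_ofReal]
    ring
  have hi3 := hi2.const_mul ((P n).eval z)
  have hsub := integral_sub (hi1.add (hM.integrable_eval (conjPoly T * P n))) hi3
  simp only [Pi.add_apply] at hsub
  rw [← add_zero (conj ((P k).eval (conj z)) * _), ← hT0, inner_cauchyLp_conj hM hz,
    inner_cauchyLp, inner_polyToLp, inner_polyToLp, ← integral_const_mul, ← integral_const_mul,
    ← integral_add hi1 (hM.integrable_eval _), ← hsub]
  congr 1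
  funext x
  have hx := sub_real_ne_zero hz x
  have e1 := eval_eq_eval_add_divByMonic (P n) z x
  have e2 := congrArg conj (eval_eq_eval_add_divByMonic (P k) (conj z) x)
  rw [← hT] at e2
  simp only [map_add, map_mul, map_sub, Complex.conj_ofReal, Complex.conj_conj] at e2
  simp only [eval_mul, eval_conjPoly_ofReal]
  set a := (P n /ₘ (X - C z)).eval (x : ℂ)
  set b := (P n).eval (x : ℂ)
  set b0 := (P n).eval z
  set c := conj ((P k).eval (x : ℂ))
  set c0 := conj ((P k).eval (conj z))
  set d := conj (T.eval (x : ℂ))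
  field_simp
  linear_combination (-c) * e1 + b * e2

end

/-! ### A discrete Gronwall inequality -/

/-- Induct on the bracket `1 + R ∑ b k * t k` rather than on `t`: each step multiplies it by at most
`1 + R b n ² ≤ exp (R b n ²)`. -/
theorem le_mul_exp_of_le_mul_one_add_sum {t b : ℕ → ℝ} {R : ℝ} (hR : 0 ≤ R) (hb : ∀ n, 0 ≤ b n)
    (h : ∀ n, t n ≤ b n * (1 + R * ∑ k ∈ Finset.range n, b k * t k)) (n : ℕ) :
    t n ≤ b n * Real.exp (R * ∑ k ∈ Finset.range n, b k ^ 2) := by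
  have key : ∀ n, 1 + R * ∑ k ∈ Finset.range n, b k * t k ≤
      Real.exp (R * ∑ k ∈ Finset.range n, b k ^ 2) := by
    intro n
    induction n with
    | zero => simp
    | succ n ih =>
      rw [Finset.sum_range_succ, Finset.sum_range_succ, mul_add, mul_add, Real.exp_add]
      set u := 1 + R * ∑ k ∈ Finset.range n, b k * t k with hu
      have h1 : b n * t n ≤ b n ^ 2 * u := by
        rw [sq, mul_assoc]
        exact mul_le_mul_of_nonneg_left (h n) (hb n)
      have h2 : R * (b n * t n) ≤ R * b n ^ 2 * Real.exp (R * ∑ k ∈ Finset.range n, b k ^ 2) := by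
        calc R * (b n * t n) ≤ R * (b n ^ 2 * u) := mul_le_mul_of_nonneg_left h1 hR
          _ = R * b n ^ 2 * u := by ring
          _ ≤ _ := mul_le_mul_of_nonneg_left ih (by positivity)
      have h3 : R * b n ^ 2 + 1 ≤ Real.exp (R * b n ^ 2) := Real.add_one_le_exp _
      have h4 := mul_le_mul_of_nonneg_left h3
        (Real.exp_pos (R * ∑ k ∈ Finset.range n, b k ^ 2)).le
      rw [← add_assoc, ← hu]
      linarith
  exact (h n).trans (mul_le_mul_of_nonneg_left (key n) (hb n))

/-! ### Locally bounded point evaluation -/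

theorem IsOrthoPoly.exists_norm_eval_le {M : Measure ℝ} {hM : HasFiniteMoments M} {P : ℕ → ℂ[X]}
    (hP : IsOrthoPoly hM P) {z₀ : ℂ} (hz₀ : z₀.im ≠ 0)
    (h1 : ∃ C, ∀ p : ℂ[X], ‖p.eval z₀‖ ≤ C * ‖polyToLp hM p‖)
    (h2 : ∃ C, ∀ p : ℂ[X], ‖p.eval (conj z₀)‖ ≤ C * ‖polyToLp hM p‖) (R : ℝ) :
    ∃ C, ∀ z : ℂ, ‖z‖ ≤ R → ∀ p : ℂ[X], ‖p.eval z‖ ≤ C * ‖polyToLp hM p‖ := by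
  set b₁ : ℕ → ℝ := fun n => ‖(P n).eval z₀‖ with hb₁
  set b₂ : ℕ → ℝ := fun n => ‖(P n).eval (conj z₀)‖ with hb₂
  set b₃ : ℕ → ℝ := fun n =>
    ‖inner ℂ (polyToLp hM (P n)) (cauchyLp hM (conj_im_ne_zero hz₀))‖ with hb₃
  set b₄ : ℕ → ℝ := fun n => ‖inner ℂ (polyToLp hM (P n)) (cauchyLp hM hz₀)‖ with hb₄
  have hs₁ : Summable fun n => b₁ n ^ 2 := hP.summable_sq_eval h1
  have hs₂ : Summable fun n => b₂ n ^ 2 := hP.summable_sq_eval h2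
  have hs₃ : Summable fun n => b₃ n ^ 2 := hP.orthonormal.inner_products_summable _
  have hs₄ : Summable fun n => b₄ n ^ 2 := hP.orthonormal.inner_products_summable _
  -- One square-summable sequence dominating all four: `b₁`, `b₂` are summable by the point bounds,
  -- `b₃`, `b₄` by Bessel's inequality.
  set b : ℕ → ℝ := fun n => b₁ n + b₂ n + b₃ n + b₄ n with hb
  have p₁ : ∀ n, 0 ≤ b₁ n := fun n => norm_nonneg _
  have p₂ : ∀ n, 0 ≤ b₂ n := fun n => norm_nonneg _
  have p₃ : ∀ n, 0 ≤ b₃ n := fun n => norm_nonneg _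
  have p₄ : ∀ n, 0 ≤ b₄ n := fun n => norm_nonneg _
  have hb0 : ∀ n, 0 ≤ b n := fun n =>
    add_nonneg (add_nonneg (add_nonneg (p₁ n) (p₂ n)) (p₃ n)) (p₄ n)
  have hs : Summable fun n => b n ^ 2 := by
    refine Summable.of_nonneg_of_le (fun n => sq_nonneg _) (fun n => ?_)
      ((((hs₁.add hs₂).add hs₃).add hs₄).mul_left 4)
    simp only [hb]
    nlinarith [sq_nonneg (b₁ n - b₂ n), sq_nonneg (b₁ n - b₃ n), sq_nonneg (b₁ n - b₄ n),
      sq_nonneg (b₂ n - b₃ n), sq_nonneg (b₂ n - b₄ n), sq_nonneg (b₃ n - b₄ n)]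
  have hentry : ∀ k n, k < n →
      ‖inner ℂ (polyToLp hM (P k)) (polyToLp hM (P n /ₘ (X - C z₀)))‖ ≤ b n * b k := by
    intro k n hkn
    rw [hP.inner_divByMonic hz₀ hkn]
    refine (norm_sub_le _ _).trans ?_
    rw [norm_mul, norm_mul, RCLike.norm_conj, norm_inner_symm]
    change b₂ k * b₃ n + b₁ n * b₄ k ≤ (b₁ n + b₂ n + b₃ n + b₄ n) * (b₁ k + b₂ k + b₃ k + b₄ k)
    have := p₁ n; have := p₂ n; have := p₃ n; have := p₄ n
    have := p₁ k; have := p₂ k; have := p₃ k; have := p₄ k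
    have h1 : b₃ n * b₂ k ≤ (b₂ n + b₃ n + b₄ n) * (b₁ k + b₂ k + b₃ k + b₄ k) := by
      gcongr <;> linarith
    have h2 : b₁ n * b₄ k ≤ b₁ n * (b₁ k + b₂ k + b₃ k + b₄ k) := by
      gcongr; linarith
    linarith
  set S := ∑' n, b n ^ 2 with hS
  set R' := |R| + ‖z₀‖ with hR'
  have hR'0 : 0 ≤ R' := by positivity
  have hgron : ∀ z : ℂ, ‖z‖ ≤ R → ∀ n, ‖(P n).eval z‖ ≤ b n * Real.exp (R' * S) := by
    intro z hz n
    have hzz : ‖z - z₀‖ ≤ R' := (norm_sub_le _ _).trans (by linarith [le_abs_self R])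
    refine (le_mul_exp_of_le_mul_one_add_sum (t := fun n => ‖(P n).eval z‖) hR'0 hb0 ?_ n).trans ?_
    · intro n
      have e := eval_eq_eval_add_divByMonic (P n) z₀ z
      -- The quotient has degree below `n`, so only `P k` with `k < n` occur: this is the recursion
      -- to which Gronwall applies.
      rw [hP.eq_sum n _ (divByMonic_X_sub_C_mem_degreeLT (hP.mem_degreeLT n) z₀),
        eval_finsetSum] at e
      rw [e, mul_add, mul_one]
      refine (norm_add_le _ _).trans (add_le_add ?_ ?_)
      · change b₁ n ≤ b₁ n + b₂ n + b₃ n + b₄ n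
        linarith [p₂ n, p₃ n, p₄ n]
      · rw [norm_mul, mul_left_comm, Finset.mul_sum]
        refine mul_le_mul hzz ((norm_sum_le _ _).trans (Finset.sum_le_sum fun k hk => ?_))
          (norm_nonneg _) hR'0
        rw [eval_smul, smul_eq_mul, norm_mul, ← mul_assoc]
        exact mul_le_mul_of_nonneg_right (hentry k n (Finset.mem_range.1 hk)) (norm_nonneg _)
    · refine mul_le_mul_of_nonneg_left (Real.exp_le_exp.2 ?_) (hb0 n)
      exact mul_le_mul_of_nonneg_left (hs.sum_le_tsum _ fun _ _ => sq_nonneg _) hR'0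
  refine ⟨Real.exp (R' * S) * √S, fun z hz p => ?_⟩
  have hpm : p ∈ degreeLT ℂ (p.natDegree + 1) := by
    rw [Polynomial.mem_degreeLT]
    exact degree_le_natDegree.trans_lt (by exact_mod_cast Nat.lt_succ_self _)
  set N := p.natDegree + 1
  set c := fun k => inner ℂ (polyToLp hM (P k)) (polyToLp hM p) with hc
  have e : p.eval z = ∑ k ∈ Finset.range N, c k * (P k).eval z := by
    conv_lhs => rw [hP.eq_sum N p hpm, eval_finsetSum]
    simp_rw [eval_smul, smul_eq_mul, hc]
  calc ‖p.eval z‖ ≤ ∑ k ∈ Finset.range N, ‖c k‖ * (b k * Real.exp (R' * S)) := by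
        rw [e]
        refine (norm_sum_le _ _).trans (Finset.sum_le_sum fun k _ => ?_)
        rw [norm_mul]
        exact mul_le_mul_of_nonneg_left (hgron z hz k) (norm_nonneg _)
    _ = Real.exp (R' * S) * ∑ k ∈ Finset.range N, ‖c k‖ * b k := by
        rw [Finset.mul_sum]
        exact Finset.sum_congr rfl fun k _ => by ring
    -- Cauchy–Schwarz; the coefficients `c k` then contribute `‖p‖` by Parseval.
    _ ≤ Real.exp (R' * S) * (√(∑ k ∈ Finset.range N, ‖c k‖ ^ 2) *
          √(∑ k ∈ Finset.range N, b k ^ 2)) :=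
        mul_le_mul_of_nonneg_left (Real.sum_mul_le_sqrt_mul_sqrt _ _ _) (Real.exp_pos _).le
    _ ≤ Real.exp (R' * S) * (‖polyToLp hM p‖ * √S) := by
        rw [← hP.norm_sq_eq_sum hpm, Real.sqrt_sq (norm_nonneg _)]
        gcongr
        exact hs.sum_le_tsum _ fun _ _ => sq_nonneg _
    _ = _ := by ring

theorem Indeterminate.exists_norm_eval_le {M : Measure ℝ} (hM : HasFiniteMoments M)
    (h : Indeterminate M) (R : ℝ) :
    ∃ C, ∀ z : ℂ, ‖z‖ ≤ R → ∀ p : ℂ[X], ‖p.eval z‖ ≤ C * ‖polyToLp hM p‖ := by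
  obtain ⟨z₀, hz₀, h1, h2⟩ := h.exists_bounded_eval hM
  obtain ⟨P, hP⟩ := exists_isOrthoPoly hM (polyToLp_injective hM hz₀ h1)
  exact hP.exists_norm_eval_le hz₀ h1 h2 R

/-! ### Finite sequences as polynomials -/

theorem finite_support (g : finiteSeq) : (Function.support fun n => (g : EllTwo) n).Finite := g.2

/-- The polynomial `∑ gₙ Xⁿ`. -/
def toPoly (g : finiteSeq) : ℂ[X] :=
  ∑ n ∈ (finite_support g).toFinset, monomial n ((g : EllTwo) n)

theorem coeff_toPoly (g : finiteSeq) (n : ℕ) : (toPoly g).coeff n = (g : EllTwo) n := by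
  simp only [toPoly, finsetSum_coeff, coeff_monomial, Finset.sum_ite_eq', Set.Finite.mem_toFinset,
    Function.mem_support]
  split_ifs with h
  · rfl
  · exact (not_not.1 h).symm

theorem toPoly_sub (g h : finiteSeq) : toPoly (g - h) = toPoly g - toPoly h := by
  ext n
  simp [coeff_toPoly]

theorem polyFun_eq_eval_toPoly (g : finiteSeq) (x : ℝ) :
    polyFun g x = (toPoly g).eval (x : ℂ) := by
  rw [polyFun, toPoly, eval_finsetSum]
  simp_rw [eval_monomial]
  refine finsum_eq_sum_of_support_subset _ ?_
  rw [Set.Finite.coe_toFinset]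
  exact Function.support_mul_subset_left _ _

theorem polyOp_apply {M : Measure ℝ} (hM : HasFiniteMoments M) (g : finiteSeq) :
    polyOp M hM g = polyToLp hM (toPoly g) := by
  change (polyFun_memLp hM g).toLp (polyFun g) = (hM.memLp_eval (toPoly g)).toLp _
  congr 1
  funext x
  exact polyFun_eq_eval_toPoly g x

theorem inner_polyToLp_monomial {M : Measure ℝ} (hM : HasFiniteMoments M) (m n : ℕ) (a b : ℂ) :
    inner ℂ (polyToLp hM (monomial m a)) (polyToLp hM (monomial n b)) =
      (moment M (n + m) : ℂ) * b * conj a := by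
  rw [inner_polyToLp]
  have : ∀ x : ℝ, (conjPoly (monomial m a) * monomial n b).eval (x : ℂ) =
      (conj a * b) * (x : ℂ) ^ (n + m) := by
    intro x
    rw [eval_mul, eval_conjPoly_ofReal, eval_monomial, eval_monomial, map_mul, map_pow,
      Complex.conj_ofReal]
    ring
  simp_rw [this]
  rw [integral_const_mul, integral_ofReal_pow]
  ring

/-- The Hankel form is the form of the operator `A`: `q[g, h] = ⟨Ag, Ah⟩`. -/
theorem hankelForm_eq_inner {M : Measure ℝ} (hM : HasFiniteMoments M) (g h : finiteSeq) :
    hankelForm (moment M) g h = inner ℂ (polyToLp hM (toPoly h)) (polyToLp hM (toPoly g)) := by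
  have hg : (Function.support fun n => (g : EllTwo) n).Finite := finite_support g
  have hh : (Function.support fun n => (h : EllTwo) n).Finite := finite_support h
  have e : ∀ n, ∑ᶠ m : ℕ, (moment M (n + m) : ℂ) * (g : EllTwo) n * conj ((h : EllTwo) m) =
      ∑ m ∈ hh.toFinset, (moment M (n + m) : ℂ) * (g : EllTwo) n * conj ((h : EllTwo) m) := by
    intro n
    refine finsum_eq_sum_of_support_subset _ fun m hm => ?_
    rw [Set.Finite.coe_toFinset]
    intro h0
    exact hm (by simp [h0])
  rw [hankelForm]
  simp_rw [e]
  rw [finsum_eq_sum_of_support_subset (s := hg.toFinset)]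
  · rw [toPoly, toPoly, map_sum, map_sum, inner_sum]
    refine Finset.sum_congr rfl fun n _ => ?_
    rw [sum_inner]
    exact Finset.sum_congr rfl fun m _ => (inner_polyToLp_monomial hM m n _ _).symm
  · intro n hn
    rw [Set.Finite.coe_toFinset]
    intro h0
    exact hn (by simp [h0])

theorem hankelForm_self {M : Measure ℝ} (hM : HasFiniteMoments M) (g : finiteSeq) :
    hankelForm (moment M) g g = ((‖polyToLp hM (toPoly g)‖ ^ 2 : ℝ) : ℂ) := by
  rw [hankelForm_eq_inner hM, inner_self_eq_norm_sq_to_K]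
  push_cast
  rfl

theorem tendsto_ofReal_sq_zero_iff {ι : Type*} {l : Filter ι} {a : ι → ℝ} (ha : ∀ i, 0 ≤ a i) :
    Tendsto (fun i => ((a i ^ 2 : ℝ) : ℂ)) l (𝓝 0) ↔ Tendsto a l (𝓝 0) := by
  constructor
  · intro h
    have h1 := h.norm
    simp only [Complex.norm_real, norm_zero] at h1
    have h2 := (Real.continuous_sqrt.tendsto _).comp h1
    rw [Real.sqrt_zero] at h2
    refine h2.congr fun i => ?_
    simp [Real.sqrt_sq (ha i)]
  · intro h
    have h1 := (Complex.continuous_ofReal.tendsto _).comp (h.pow 2)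
    rwa [zero_pow two_ne_zero, Complex.ofReal_zero] at h1

theorem tendsto_hankelForm_self_iff {M : Measure ℝ} (hM : HasFiniteMoments M)
    {ι : Type*} {l : Filter ι} {u : ι → finiteSeq} :
    Tendsto (fun n => hankelForm (moment M) (u n) (u n)) l (𝓝 0) ↔
      Tendsto (fun n => polyToLp hM (toPoly (u n))) l (𝓝 0) := by
  simp_rw [hankelForm_self hM]
  rw [tendsto_ofReal_sq_zero_iff fun _ => norm_nonneg _, ← tendsto_zero_iff_norm_tendsto_zero]

theorem tendsto_hankelForm_sub_iff {M : Measure ℝ} (hM : HasFiniteMoments M)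
    {u : ℕ → finiteSeq} :
    Tendsto (fun p : ℕ × ℕ => hankelForm (moment M) (u p.1 - u p.2) (u p.1 - u p.2)) atTop (𝓝 0) ↔
      CauchySeq fun n => polyToLp hM (toPoly (u n)) := by
  rw [tendsto_hankelForm_self_iff hM (u := fun p : ℕ × ℕ => u p.1 - u p.2),
    cauchySeq_iff_tendsto_dist_atTop_0, tendsto_zero_iff_norm_tendsto_zero]
  simp_rw [toPoly_sub, map_sub, dist_eq_norm]

/-! ### Closability of the operator and of the form -/

theorem isClosable_iff_graph {E F : Type*} [NormedAddCommGroup E] [NormedSpace ℂ E]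
    [NormedAddCommGroup F] [NormedSpace ℂ F] (f : E →ₗ.[ℂ] F) :
    f.IsClosable ↔ ∀ y : F, ((0 : E), y) ∈ f.graph.topologicalClosure → y = 0 := by
  constructor
  · rintro ⟨f', hf'⟩ y hy
    rw [hf'] at hy
    exact f'.graph_fst_eq_zero_snd hy rfl
  · intro h
    refine ⟨f.graph.topologicalClosure.toLinearPMap,
      (Submodule.toLinearPMap_graph_eq _ ?_).symm⟩
    rintro ⟨x, y⟩ hxy hx
    obtain rfl : x = 0 := hx
    exact h y hxy

theorem polyOp_isClosable_iff {M : Measure ℝ} (hM : HasFiniteMoments M) :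
    (polyOp M hM).IsClosable ↔ ∀ (u : ℕ → finiteSeq) (y : Lp ℂ 2 M),
      Tendsto (fun n => (u n : EllTwo)) atTop (𝓝 0) →
      Tendsto (fun n => polyToLp hM (toPoly (u n))) atTop (𝓝 y) → y = 0 := by
  rw [isClosable_iff_graph]
  constructor
  · intro h u y hu hy
    refine h y ?_
    rw [← SetLike.mem_coe, Submodule.topologicalClosure_coe]
    refine mem_closure_of_tendsto (hu.prodMk_nhds hy) (Eventually.of_forall fun n => ?_)
    rw [← polyOp_apply]
    exact (polyOp M hM).mem_graph (u n)
  · intro h y hy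
    rw [← SetLike.mem_coe, Submodule.topologicalClosure_coe, mem_closure_iff_seq_limit] at hy
    obtain ⟨w, hw, hlim⟩ := hy
    have hw' : ∀ n, ∃ g : finiteSeq, (g : EllTwo) = (w n).1 ∧
        polyToLp hM (toPoly g) = (w n).2 := by
      intro n
      obtain ⟨g, hg1, hg2⟩ := (polyOp M hM).mem_graph_iff.1 (hw n)
      exact ⟨g, hg1, (polyOp_apply hM g).symm.trans hg2⟩
    choose u hu1 hu2 using hw'
    rw [nhds_prod_eq] at hlim
    refine h u y ?_ ?_
    · simp_rw [hu1]
      exact tendsto_fst.comp hlim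
    · simp_rw [hu2]
      exact tendsto_snd.comp hlim

/-- As `q[g, g] = ‖Ag‖²`, the form condition speaks of Cauchy sequences `A u n` and the operator
condition of convergent ones. Completeness of `L²(M)` identifies the two. -/
theorem formIsClosable_iff_polyOp_isClosable {M : Measure ℝ} (hM : HasFiniteMoments M) :
    FormIsClosable finiteSeq (hankelForm (moment M)) ↔ (polyOp M hM).IsClosable := by
  rw [polyOp_isClosable_iff]
  constructor
  · intro h u y hu hy
    have h1 := h u hu ((tendsto_hankelForm_sub_iff hM).2 hy.cauchySeq)
    exact tendsto_nhds_unique hy ((tendsto_hankelForm_self_iff hM).1 h1)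
  · intro h u hu hq
    obtain ⟨y, hy⟩ := cauchySeq_tendsto_of_complete ((tendsto_hankelForm_sub_iff hM).1 hq)
    rw [h u y hu hy] at hy
    exact (tendsto_hankelForm_self_iff hM).2 hy

/-! ### Indeterminate measures -/

/-- Each coefficient is at most the `ℓ²` norm; sum the geometric series. -/
theorem norm_eval_toPoly_le (g : finiteSeq) {z : ℂ} (hz : ‖z‖ < 1) :
    ‖(toPoly g).eval z‖ ≤ ‖(g : EllTwo)‖ * (1 - ‖z‖)⁻¹ := by
  rw [toPoly, eval_finsetSum, ← tsum_geometric_of_lt_one (norm_nonneg z) hz]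
  refine (norm_sum_le _ _).trans ?_
  calc ∑ n ∈ (finite_support g).toFinset, ‖(monomial n ((g : EllTwo) n)).eval z‖
      ≤ ∑ n ∈ (finite_support g).toFinset, ‖(g : EllTwo)‖ * ‖z‖ ^ n := by
        refine Finset.sum_le_sum fun n _ => ?_
        rw [eval_monomial, norm_mul, norm_pow]
        exact mul_le_mul_of_nonneg_right (lp.norm_apply_le_norm two_ne_zero _ n) (by positivity)
    _ = ‖(g : EllTwo)‖ * ∑ n ∈ (finite_support g).toFinset, ‖z‖ ^ n := (Finset.mul_sum _ _ _).symm
    _ ≤ _ := mul_le_mul_of_nonneg_left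
        ((summable_geometric_of_lt_one (norm_nonneg z) hz).sum_le_tsum _
          fun _ _ => by positivity) (norm_nonneg _)

/-- If point evaluations are locally bounded in the norm of `L²(M)`, then a sequence of polynomials
that is Cauchy in `L²(M)` and whose coefficients tend to zero in `ℓ²` tends to zero pointwise. -/
theorem tendsto_eval_toPoly_zero {M : Measure ℝ} (hM : HasFiniteMoments M)
    (hev : ∀ R : ℝ, ∃ C, ∀ z : ℂ, ‖z‖ ≤ R → ∀ p : ℂ[X], ‖p.eval z‖ ≤ C * ‖polyToLp hM p‖)
    {u : ℕ → finiteSeq} (hu : Tendsto (fun n => (u n : EllTwo)) atTop (𝓝 0))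
    (hc : CauchySeq fun n => polyToLp hM (toPoly (u n))) (z : ℂ) :
    Tendsto (fun n => (toPoly (u n)).eval z) atTop (𝓝 0) := by
  have hunif : ∀ R : ℝ, UniformCauchySeqOn (fun n z => (toPoly (u n)).eval z) atTop
      (Metric.closedBall (0 : ℂ) R) := by
    intro R
    obtain ⟨C, hC⟩ := hev R
    -- The constant is enlarged so that it is positive and can be divided by.
    have hC' : ∀ z : ℂ, ‖z‖ ≤ R → ∀ p : ℂ[X], ‖p.eval z‖ ≤ (|C| + 1) * ‖polyToLp hM p‖ :=
      fun z hz p => (hC z hz p).trans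
        (mul_le_mul_of_nonneg_right (by linarith [le_abs_self C]) (norm_nonneg _))
    have hC0 : 0 < |C| + 1 := by positivity
    rw [Metric.uniformCauchySeqOn_iff]
    intro ε hε
    obtain ⟨N, hN⟩ := Metric.cauchySeq_iff.1 hc (ε / (|C| + 1)) (by positivity)
    refine ⟨N, fun m hm n hn z hz => ?_⟩
    have h1 := hN m hm n hn
    rw [dist_eq_norm, ← map_sub, lt_div_iff₀ hC0] at h1
    rw [dist_eq_norm, ← eval_sub]
    refine (hC' z (mem_closedBall_zero_iff.1 hz) _).trans_lt ?_
    rwa [mul_comm]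
  have hlim : ∀ z : ℂ, ∃ w, Tendsto (fun n => (toPoly (u n)).eval z) atTop (𝓝 w) := fun z =>
    cauchySeq_tendsto_of_complete ((hunif ‖z‖).cauchySeq (by simp))
  choose F hF using hlim
  have hloc : TendstoLocallyUniformlyOn (fun n z => (toPoly (u n)).eval z) F atTop Set.univ := by
    rw [tendstoLocallyUniformlyOn_iff_forall_isCompact isOpen_univ]
    intro K _ hK
    obtain ⟨R, hR⟩ := hK.isBounded.subset_closedBall 0
    exact ((hunif R).tendstoUniformlyOn_of_tendsto fun z _ => hF z).mono hR
  have hdiff : DifferentiableOn ℂ F Set.univ :=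
    hloc.differentiableOn
      (Eventually.of_forall fun n => (toPoly (u n)).differentiable.differentiableOn) isOpen_univ
  -- On the unit disc the values are bounded by the `ℓ²` norms, which tend to zero; the identity
  -- theorem does the rest.
  have hzero : F =ᶠ[𝓝 0] fun _ => 0 := by
    filter_upwards [Metric.ball_mem_nhds (0 : ℂ) one_pos] with w hw
    rw [mem_ball_zero_iff] at hw
    refine tendsto_nhds_unique (hF w) (squeeze_zero_norm (fun n => norm_eval_toPoly_le _ hw) ?_)
    simpa using hu.norm.mul_const (1 - ‖w‖)⁻¹
  have hF0 : F = fun _ => 0 :=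
    AnalyticOnNhd.eq_of_eventuallyEq (hdiff.analyticOnNhd isOpen_univ) analyticOnNhd_const hzero
  simpa [hF0] using hF z

theorem Indeterminate.polyOp_isClosable {M : Measure ℝ} (hM : HasFiniteMoments M)
    (h : Indeterminate M) : (polyOp M hM).IsClosable := by
  rw [polyOp_isClosable_iff]
  intro u y hu hy
  have h0 := tendsto_eval_toPoly_zero hM (h.exists_norm_eval_le hM) hu hy.cauchySeq
  -- A subsequence converges almost everywhere to `y`, while the polynomials tend to zero at every
  -- point.
  obtain ⟨ns, hns, hae⟩ := (tendstoInMeasure_of_tendsto_Lp hy).exists_seq_tendsto_ae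
  rw [Lp.eq_zero_iff_ae_eq_zero]
  have hall : ∀ᵐ x ∂M, ∀ n, polyToLp hM (toPoly (u n)) x = (toPoly (u n)).eval (x : ℂ) :=
    ae_all_iff.2 fun n => coeFn_polyToLp hM _
  filter_upwards [hae, hall] with x h1 h2
  simp_rw [h2] at h1
  exact tendsto_nhds_unique h1 ((h0 x).comp hns.tendsto_atTop)

theorem Indeterminate.not_tendsto_moment {M : Measure ℝ} (hM : HasFiniteMoments M)
    (h : Indeterminate M) : ¬ Tendsto (moment M) atTop (𝓝 0) := by
  intro hq
  -- Any point outside the closed unit disc would do: the monomials grow there, and so must their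
  -- norms.
  obtain ⟨C, hC⟩ := h.exists_norm_eval_le hM 2
  have h1 : ∀ n : ℕ, (4 : ℝ) ^ n ≤ C ^ 2 * moment M (n + n) := by
    intro n
    have h2 := hC 2 (by simp) (monomial n 1)
    rw [eval_monomial, one_mul, norm_pow, Complex.norm_ofNat] at h2
    have h3 : ‖polyToLp hM (monomial n 1)‖ ^ 2 = moment M (n + n) := by
      have := inner_polyToLp_monomial hM n n 1 1
      rw [inner_self_eq_norm_sq_to_K, map_one (starRingEnd ℂ), mul_one, mul_one] at this
      have h4 : ((‖polyToLp hM (monomial n 1)‖ : ℝ) : ℂ) ^ 2 = (moment M (n + n) : ℂ) := this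
      exact_mod_cast h4
    calc (4 : ℝ) ^ n = (2 ^ n) ^ 2 := by rw [← pow_mul, mul_comm, pow_mul]; norm_num
      _ ≤ (C * ‖polyToLp hM (monomial n 1)‖) ^ 2 := pow_le_pow_left₀ (by positivity) h2 2
      _ = _ := by rw [mul_pow, h3]
  have h5 : Tendsto (fun n : ℕ => C ^ 2 * moment M (n + n)) atTop (𝓝 (C ^ 2 * 0)) :=
    (hq.comp (tendsto_atTop_mono (fun n => Nat.le_add_right n n) tendsto_id)).const_mul _
  exact not_tendsto_nhds_of_tendsto_atTop
    (tendsto_atTop_mono h1 (tendsto_pow_atTop_atTop_of_one_lt (by norm_num))) _ h5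

/-! ### An indeterminate measure -/

/-- The measure with mass `2 ^ (k - k ^ 2)` at the point `4 ^ k`, for `k` in the range of `e`. -/
def thetaMeasure (e : ℤ → ℤ) : Measure ℝ :=
  Measure.sum fun j => ENNReal.ofReal ((2 : ℝ) ^ (e j - e j ^ 2)) • Measure.dirac ((4 : ℝ) ^ e j)

/-- The contribution of the point `4 ^ k` to the moment of order `n`. -/
def thetaTerm (n : ℕ) (k : ℤ) : ℝ := (2 : ℝ) ^ ((2 * n + 1) * k - k ^ 2)

theorem thetaTerm_eq (n : ℕ) (k : ℤ) :
    thetaTerm n k = (2 : ℝ) ^ (k - k ^ 2) * ((4 : ℝ) ^ k) ^ n := by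
  have h4 : (4 : ℝ) = 2 ^ (2 : ℤ) := by norm_num
  rw [thetaTerm, h4, ← zpow_mul, ← zpow_natCast, ← zpow_mul, ← zpow_add₀ two_ne_zero]
  congr 1
  ring

/-- The exponent is `k (2n + 1 - k)`. The reflection changes the parity of `k`, so even and odd `k`
contribute equally to every moment. -/
theorem thetaTerm_symm (n : ℕ) (k : ℤ) : thetaTerm n (2 * n + 1 - k) = thetaTerm n k := by
  rw [thetaTerm, thetaTerm]
  congr 1
  ring

theorem thetaTerm_nonneg (n : ℕ) (k : ℤ) : 0 ≤ thetaTerm n k := by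
  rw [thetaTerm]
  positivity

theorem summable_thetaTerm (n : ℕ) : Summable (thetaTerm n) := by
  have h1 : Summable fun k : ℤ => (1 / 2 : ℝ) ^ k.natAbs :=
    Summable.of_nat_of_neg (by simpa using summable_geometric_two)
      (by simpa using summable_geometric_two)
  refine Summable.of_nonneg_of_le (thetaTerm_nonneg n) (fun k => ?_)
    -- The constant completes the square: `(2n + 1)|k| - k² ≤ (n + 1)² - |k|` amounts to `(|k| - (n
    -- + 1))² ≥ 0`.
    (h1.mul_left ((2 : ℝ) ^ (((n : ℤ) + 1) ^ 2)))
  have h2 : (1 / 2 : ℝ) ^ k.natAbs = (2 : ℝ) ^ (-|k|) := by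
    rw [zpow_neg, Int.abs_eq_natAbs, zpow_natCast, one_div, inv_pow]
  rw [thetaTerm, h2, ← zpow_add₀ two_ne_zero]
  refine zpow_le_zpow_right₀ one_le_two ?_
  have h3 : (2 * (n : ℤ) + 1) * k ≤ (2 * n + 1) * |k| :=
    mul_le_mul_of_nonneg_left (le_abs_self k) (by positivity)
  nlinarith [sq_nonneg (|k| - ((n : ℤ) + 1)), sq_abs k]

theorem integral_pow_thetaMeasure_term (n : ℕ) (k : ℤ) :
    ∫ x : ℝ, x ^ n ∂(ENNReal.ofReal ((2 : ℝ) ^ (k - k ^ 2)) • Measure.dirac ((4 : ℝ) ^ k)) =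
      thetaTerm n k := by
  rw [integral_smul_measure, integral_dirac, ENNReal.toReal_ofReal (by positivity), smul_eq_mul,
    thetaTerm_eq]

theorem thetaMeasure_hasFiniteMoments {e : ℤ → ℤ} (he : Function.Injective e) :
    HasFiniteMoments (thetaMeasure e) := by
  intro n
  refine integrable_sum_measure (fun j => ?_) ?_
  · exact (integrable_dirac (by simp)).smul_measure ENNReal.ofReal_ne_top
  · refine ((summable_thetaTerm n).comp_injective he).congr fun j => ?_
    rw [integral_smul_measure, integral_dirac, ENNReal.toReal_ofReal (by positivity), smul_eq_mul,
      Real.norm_of_nonneg (by positivity), ← thetaTerm_eq]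
    rfl

theorem moment_thetaMeasure {e : ℤ → ℤ} (he : Function.Injective e) (n : ℕ) :
    moment (thetaMeasure e) n = ∑' j, thetaTerm n (e j) := by
  rw [moment, thetaMeasure, ← (hasSum_integral_measure (thetaMeasure_hasFiniteMoments he n)).tsum_eq]
  simp_rw [integral_pow_thetaMeasure_term]

/-- The point `1 = 4 ^ 0` tells the even measure from the odd one. -/
theorem thetaMeasure_singleton_one (e : ℤ → ℤ) : thetaMeasure e {1} = 0 ↔ ∀ j, e j ≠ 0 := by
  rw [thetaMeasure, Measure.sum_apply _ (measurableSet_singleton _), ENNReal.tsum_eq_zero]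
  refine forall_congr' fun j => ?_
  have h1 : ENNReal.ofReal ((2 : ℝ) ^ (e j - e j ^ 2)) ≠ 0 := by
    rw [Ne, ENNReal.ofReal_eq_zero, not_le]
    positivity
  have h2 : (4 : ℝ) ^ e j = 1 ↔ e j = 0 :=
    zpow_eq_one_iff_right₀ (by norm_num) (by norm_num)
  rw [Measure.smul_apply, smul_eq_mul, mul_eq_zero, or_iff_right h1,
    Measure.dirac_apply' _ (measurableSet_singleton _)]
  simp [Set.indicator_apply, h2]

theorem indeterminate_thetaMeasure : Indeterminate (thetaMeasure fun j => 2 * j) := by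
  have he : Function.Injective fun j : ℤ => 2 * j := fun a b h => by
    simpa using h
  have ho : Function.Injective fun j : ℤ => 2 * j + 1 := fun a b h => by
    simpa using h
  refine ⟨thetaMeasure_hasFiniteMoments he, thetaMeasure fun j => 2 * j + 1,
    thetaMeasure_hasFiniteMoments ho, fun n => ?_, fun h => ?_⟩
  · rw [moment_thetaMeasure he, moment_thetaMeasure ho,
      -- Replacing `j` by `n - j` turns `2j + 1` into `2n + 1 - 2j`, the reflection of `2j`.
      ← (Equiv.subLeft (n : ℤ)).tsum_eq fun j => thetaTerm n (2 * j + 1)]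
    refine tsum_congr fun j => ?_
    rw [← thetaTerm_symm n (2 * j), Equiv.subLeft_apply]
    congr 1
    ring
  · have h1 : thetaMeasure (fun j => 2 * j + 1) {1} = 0 :=
      (thetaMeasure_singleton_one _).2 fun j => by omega
    rw [h, thetaMeasure_singleton_one] at h1
    exact h1 0 rfl

end HankelMoment

end

theorem mainTheorem1 :
    (∀ (M : Measure ℝ) (hM : HankelMoment.HasFiniteMoments M),
      HankelMoment.Indeterminate M →
        (HankelMoment.polyOp M hM).IsClosable ∧
        HankelMoment.FormIsClosable HankelMoment.finiteSeq
          (HankelMoment.hankelForm (HankelMoment.moment M)) ∧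
        ¬ Tendsto (HankelMoment.moment M) atTop (𝓝 0)) ∧
    (∀ (M : Measure ℝ) (hM : HankelMoment.HasFiniteMoments M),
      HankelMoment.FormIsClosable HankelMoment.finiteSeq
          (HankelMoment.hankelForm (HankelMoment.moment M)) ↔
        (HankelMoment.polyOp M hM).IsClosable) ∧
    (∃ (M : Measure ℝ) (hM : HankelMoment.HasFiniteMoments M),
      HankelMoment.Indeterminate M ∧
        (HankelMoment.polyOp M hM).IsClosable ∧
        ¬ Tendsto (HankelMoment.moment M) atTop (𝓝 0)) := by
  refine ⟨fun M hM h => ⟨h.polyOp_isClosable hM,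
      (HankelMoment.formIsClosable_iff_polyOp_isClosable hM).2 (h.polyOp_isClosable hM),
      h.not_tendsto_moment hM⟩,
    fun M hM => HankelMoment.formIsClosable_iff_polyOp_isClosable hM, ?_⟩
  have h := HankelMoment.indeterminate_thetaMeasure
  exact ⟨_, h.1, h, h.polyOp_isClosable h.1, h.not_tendsto_moment h.1⟩
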